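/- For a scheme $S$ and an $S$-scheme $Z$ let $T_{Z/S} := \underline{\mathrm{Spec}}_Z\,\mathrm{Sym}(\Omega^1_{Z/S})$, regarded as an $S$-scheme; this defines a functor $T_{- /S}\colon \mathbf{Sch}_{/S}\to\mathbf{Sch}_{/S}$. For a morphism $f\colon X\to Y$ let $f^*\colon \mathbf{Sch}_{/Y}\to\mathbf{Sch}_{/X}$, $f^*Z = Z\times_Y X$, and let $$({}_fT^{-1})_Z\colon T_{f^*Z/X}\longrightarrow f^*T_{Z/Y} = T_{Z/Y}\times_Y X$$ be the canonical morphism over $X$ whose first component is the map $T_{f^*Z/X}\to T_{Z/Y}$ induced by the projection $f^*Z\to Z$ over $f$. (For $X=\mathrm{Spec}\,A$, $Y=\mathrm{Spec}\,C$, $Z=\mathrm{Spec}\,B$ it is the spectrum of the ring map $\mathrm{Sym}(\Omega^1_{B/C})\otimes_C A\to \mathrm{Sym}(\Omega^1_{B\otimes_C A/A})$ given by $b\otimes a\mapsto b\otimes a$ and $\mathrm{d}b\otimes a\mapsto \mathrm{d}(b\otimes a)$.) Let $\mathbf{Sch}_{/ -}\colon \mathbf{Sch}^{\mathrm{op}}\to\mathfrak{Cat}$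 be the pseudofunctor $X\mapsto\mathbf{Sch}_{/X}$, $f\mapsto f^*$, whose compositors, for $X\xrightarrow{f}Y\xrightarrow{g}Z$, are the cancellation isomorphisms $\phi_{f,g}^W\colon f^*g^*W=(W\times_Z Y)\times_Y X\cong W\times_Z X=(g\circ f)^*W$ and whose unitors are the isomorphisms $W\times_X X\cong W$. **Proposition.** For every morphism $f\colon X\to Y$ of schemes the morphisms $({}_fT^{-1})_Z$ are isomorphisms, natural in $Z$; they are the inverse of a natural isomorphism ${}_fT\colon f^*\circ T_{- /Y}\Rightarrow T_{- /X}\circ f^*$. For every composable pair $X\xrightarrow{f}Y\xrightarrow{g}Z$ of morphisms of schemes, $$(\phi_{f,g} * T_{- /Z})\circ(f^* * {}_gT^{-1})\circ({}_fT^{-1} * g^*) \;=\; {}_{g\circ f}T^{-1}\circ(T_{- /X} * \phi_{f,g})$$ as natural transformations $T_{- /X}\circ f^*\circ g^*\Rightarrow (g\circ f)^*\circ T_{- /Z}$. Consequently the functors $T_{- /X}$, for all schemes $X$, together with the natural isomorphisms ${}_fT^{-1}$, for all morphisms $f$, are the components of a pseudonatural transformation $T\colon \mathbf{Sch}_{/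 -}\Rightarrow\mathbf{Sch}_{/ -}$. -/

import Mathlib

universe u

open CategoryTheory Limits AlgebraicGeometry Opposite

noncomputable section

namespace RelTangent

section Algebra

/-- The ring `Sym_B(Ω¹_{B/A})` attached to a ring map `φ : A ⟶ B`. -/
def symAlg {A B : CommRingCat.{u}} (φ : A ⟶ B) : CommRingCat.{u} :=
  .of (SymmetricAlgebra B (CommRingCat.KaehlerDifferential φ))

/-- The structure map `B ⟶ Sym_B(Ω¹_{B/A})`. -/
def symIncl {A B : CommRingCat.{u}} (φ : A ⟶ B) : B ⟶ symAlg φ :=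
  CommRingCat.ofHom (algebraMap B (SymmetricAlgebra B (CommRingCat.KaehlerDifferential φ)))

/-- The element `db` of `Sym_B(Ω¹_{B/A})`. -/
def symD {A B : CommRingCat.{u}} (φ : A ⟶ B) (b : B) : symAlg φ :=
  SymmetricAlgebra.ι B (CommRingCat.KaehlerDifferential φ) (CommRingCat.KaehlerDifferential.d b)

variable {A B : CommRingCat.{u}} (φ : A ⟶ B)

lemma symD_add (b b' : B) : symD φ (b + b') = symD φ b + symD φ b' := by
  simp [symD]; rfl

lemma symD_mul (b b' : B) :
    symD φ (b * b') = symIncl φ b * symD φ b' + symIncl φ b' * symD φ b := by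
  simp only [symD, ModuleCat.Derivation.d_mul, map_add, map_smul, Algebra.smul_def]; rfl

lemma symD_map (a : A) : symD φ (φ a) = 0 := by
  simp [symD]; rfl

variable {φ} in
lemma symAlg_hom_ext {R : CommRingCat.{u}} {p q : symAlg φ ⟶ R}
    (h₁ : symIncl φ ≫ p = symIncl φ ≫ q) (h₂ : ∀ b, p (symD φ b) = q (symD φ b)) : p = q := by
  let : Algebra B R := (symIncl φ ≫ p).hom.toAlgebra
  let p' : SymmetricAlgebra B (CommRingCat.KaehlerDifferential φ) →ₐ[B] R :=
    { p.hom with commutes' := fun b ↦ rfl }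
  let q' : SymmetricAlgebra B (CommRingCat.KaehlerDifferential φ) →ₐ[B] R :=
    { q.hom with commutes' := fun b ↦ (ConcreteCategory.congr_hom h₁ b).symm }
  have hpq : p' = q' := by
    apply SymmetricAlgebra.algHom_ext
    have : (ModuleCat.ofHom (X := CommRingCat.KaehlerDifferential φ) (Y := ModuleCat.of B R)
        (p'.toLinearMap ∘ₗ SymmetricAlgebra.ι B _)) = ModuleCat.ofHom
        (q'.toLinearMap ∘ₗ SymmetricAlgebra.ι B _) := by
      apply CommRingCat.KaehlerDifferential.ext
      exact h₂
    exact congrArg ModuleCat.Hom.hom this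
  ext x
  exact congr($hpq x)

/-- The ring map out of `Sym_B(Ω¹_{B/A})` determined by a ring map `p : B ⟶ R` and an `A`-linear
derivation `δ : B → R` along `p`. -/
def symDesc {R : CommRingCat.{u}} (p : B ⟶ R) (δ : B → R)
    (hadd : ∀ b b', δ (b + b') = δ b + δ b')
    (hmul : ∀ b b', δ (b * b') = p b * δ b' + p b' * δ b)
    (hmap : ∀ a, δ (φ a) = 0) : symAlg φ ⟶ R :=
  letI : Algebra B R := p.hom.toAlgebra
  CommRingCat.ofHom (SymmetricAlgebra.lift (M := CommRingCat.KaehlerDifferential φ) (R := B)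
    (A := R) (ModuleCat.Derivation.desc (M := ModuleCat.of B R)
      (ModuleCat.Derivation.mk δ hadd hmul hmap)).hom).toRingHom

section
variable {R : CommRingCat.{u}} (p : B ⟶ R) (δ : B → R)
    (hadd : ∀ b b', δ (b + b') = δ b + δ b')
    (hmul : ∀ b b', δ (b * b') = p b * δ b' + p b' * δ b)
    (hmap : ∀ a, δ (φ a) = 0)

lemma symIncl_desc : symIncl φ ≫ symDesc φ p δ hadd hmul hmap = p := by
  let : Algebra B R := p.hom.toAlgebra
  ext b
  exact AlgHom.commutes (SymmetricAlgebra.lift (M := CommRingCat.KaehlerDifferential φ) (R := B)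
    (A := R) (ModuleCat.Derivation.desc (M := ModuleCat.of B R)
      (ModuleCat.Derivation.mk δ hadd hmul hmap)).hom) b

lemma symDesc_d (b : B) : symDesc φ p δ hadd hmul hmap (symD φ b) = δ b := by
  let : Algebra B R := p.hom.toAlgebra
  refine (SymmetricAlgebra.lift_ι_apply (M := CommRingCat.KaehlerDifferential φ) (R := B)
    (A := R) (ModuleCat.Derivation.desc (M := ModuleCat.of B R)
      (ModuleCat.Derivation.mk δ hadd hmul hmap)).hom _).trans ?_
  exact ModuleCat.Derivation.desc_d (M := ModuleCat.of B R)
    (ModuleCat.Derivation.mk δ hadd hmul hmap) b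
end

section
variable {φ} {B' : CommRingCat.{u}}

lemma eq_zero_of_formallyUnramified {α : A ⟶ B} (hα : α.hom.FormallyUnramified)
    {R : CommRingCat.{u}} (p : B ⟶ R) (δ : B → R)
    (hadd : ∀ b b', δ (b + b') = δ b + δ b')
    (hmul : ∀ b b', δ (b * b') = p b * δ b' + p b' * δ b)
    (hmap : ∀ a, δ (α a) = 0) (b : B) : δ b = 0 := by
  have : (CommRingCat.KaehlerDifferential.d b : CommRingCat.KaehlerDifferential α) = 0 := by
    algebraize [α.hom]
    exact (Algebra.FormallyUnramified.subsingleton_kaehlerDifferential (R := A) (A := B)).elim _ _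
  rw [← symDesc_d α p δ hadd hmul hmap, symD, this, map_zero]
  exact map_zero (symDesc α p δ hadd hmul hmap).hom

lemma exists_extension_of_formallyEtale {β : B ⟶ B'} (hβ : β.hom.FormallyEtale)
    {R : CommRingCat.{u}} (p : B' ⟶ R) (δ : B → R)
    (hadd : ∀ b b', δ (b + b') = δ b + δ b')
    (hmul : ∀ b b', δ (b * b') = p (β b) * δ b' + p (β b') * δ b)
    (hmap : ∀ a, δ (φ a) = 0) :
    ∃ δ' : B' → R, (∀ b b', δ' (b + b') = δ' b + δ' b') ∧
      (∀ b b', δ' (b * b') = p b * δ' b' + p b' * δ' b) ∧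
      (∀ a, δ' (β (φ a)) = 0) ∧ ∀ b, δ' (β b) = δ b := by
  algebraize [φ.hom, β.hom, p.hom, β.hom.comp φ.hom, p.hom.comp β.hom,
    (p.hom.comp β.hom).comp φ.hom]
  have : IsScalarTower A B R := .of_algebraMap_eq' rfl
  have : IsScalarTower A B' R := .of_algebraMap_eq' rfl
  let δ₀ : Derivation A B R :=
    { toFun := δ
      map_add' := hadd
      map_smul' := fun a b ↦ by
        rw [Algebra.smul_def, Algebra.smul_def]
        refine (hmul _ _).trans ?_
        erw [hmap]
        rw [mul_zero, add_zero]; rfl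
      map_one_eq_zero' := by
        have := hmap 1
        simpa using this
      leibniz' := fun a b ↦ by
        simp only [Algebra.smul_def]
        exact hmul a b }
  let L : TensorProduct B B' (Ω[B⁄A]) →ₗ[B'] R :=
    LinearMap.liftBaseChange B' δ₀.liftKaehlerDifferential
  let L' : Ω[B'⁄A] →ₗ[B'] R :=
    L ∘ₗ (KaehlerDifferential.tensorKaehlerEquivOfFormallyEtale A B B').symm.toLinearMap
  let δ' : Derivation A B' R := L'.compDer (KaehlerDifferential.D A B')
  refine ⟨δ', map_add δ', fun b b' ↦ ?_, fun a ↦ δ'.map_algebraMap a, fun b ↦ ?_⟩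
  · exact (δ'.leibniz b b').trans (by simp only [Algebra.smul_def]; rfl)
  · change L ((KaehlerDifferential.tensorKaehlerEquivOfFormallyEtale A B B').symm
      (KaehlerDifferential.D A B' (algebraMap B B' b))) = _
    rw [KaehlerDifferential.tensorKaehlerEquivOfFormallyEtale_symm_D_algebraMap]
    simp [L]
    rfl

end

variable {φ}

/-- A commutative square of rings induces the ring map `b ↦ β b`, `db ↦ d(β b)`. -/
def symMap {A' B' : CommRingCat.{u}} {φ' : A' ⟶ B'} (α : A ⟶ A') (β : B ⟶ B')
    (h : φ ≫ β = α ≫ φ') : symAlg φ ⟶ symAlg φ' :=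
  symDesc φ (β ≫ symIncl φ') (fun b ↦ symD φ' (β b)) (by simp [symD_add]) (by simp [symD_mul])
    (fun a ↦ by
      have : β (φ a) = φ' (α a) := ConcreteCategory.congr_hom h a
      rw [this, symD_map])

section
variable {A' B' : CommRingCat.{u}} {φ' : A' ⟶ B'} (α : A ⟶ A') (β : B ⟶ B')
    (h : φ ≫ β = α ≫ φ')

@[simp]
lemma symIncl_map : symIncl φ ≫ symMap α β h = β ≫ symIncl φ' := symIncl_desc ..

@[simp]
lemma symIncl_map_assoc {R : CommRingCat.{u}} (q : symAlg φ' ⟶ R) :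
    symIncl φ ≫ symMap α β h ≫ q = β ≫ symIncl φ' ≫ q := by
  rw [← Category.assoc, symIncl_map, Category.assoc]

@[simp]
lemma symMap_d (b : B) : symMap α β h (symD φ b) = symD φ' (β b) := symDesc_d ..

lemma symMap_id (h) : symMap (φ := φ) (φ' := φ) (𝟙 _) (𝟙 _) h = 𝟙 _ :=
  symAlg_hom_ext (by simp) (by simp)

lemma symMap_comp {A'' B'' : CommRingCat.{u}} {φ'' : A'' ⟶ B''} (α' : A' ⟶ A'') (β' : B' ⟶ B'')
    (h' : φ' ≫ β' = α' ≫ φ'') (h'') :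
    symMap (φ := φ) (φ' := φ'') (α ≫ α') (β ≫ β') h'' = symMap α β h ≫ symMap α' β' h' :=
  symAlg_hom_ext (by simp) (by simp)

/-- `Sym(Ω¹)` is compatible with localisation: if `A ⟶ A'` is formally unramified and `B ⟶ B'` is
formally étale, then `Sym_{B'}(Ω¹_{B'/A'}) = B' ⊗_B Sym_B(Ω¹_{B/A})`. -/
lemma isPushout_symMap (hα : α.hom.FormallyUnramified) (hβ : β.hom.FormallyEtale) :
    IsPushout β (symIncl φ) (symIncl φ') (symMap α β h) := by
  refine ⟨⟨by simp⟩, ⟨PushoutCocone.isColimitAux' _ fun s ↦ ?_⟩⟩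
  have hs (b : B) : s.inr (symIncl φ b) = s.inl (β b) :=
    (ConcreteCategory.congr_hom s.condition b).symm
  have ex := exists_extension_of_formallyEtale (φ := φ) hβ s.inl (fun b ↦ s.inr (symD φ b))
    (by simp [symD_add]) (by simp [symD_mul, hs]) (by simp [symD_map])
  let δ := ex.choose
  obtain ⟨hadd, hmul, hmap, hd⟩ : _ ∧ _ ∧ _ ∧ _ := ex.choose_spec
  have hA (a : A) : φ' (α a) = β (φ a) := (ConcreteCategory.congr_hom h a).symm
  have hmap' : ∀ a, δ (φ' a) = 0 :=
    eq_zero_of_formallyUnramified hα (φ' ≫ s.inl) (fun a ↦ δ (φ' a))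
      (by simp [δ, hadd]) (by simp [δ, hmul]) (fun a ↦ by rw [hA]; exact hmap a)
  refine ⟨symDesc φ' s.inl δ hadd hmul hmap', symIncl_desc .., ?_, ?_⟩
  · refine symAlg_hom_ext ?_ fun b ↦ ?_
    · change symIncl φ ≫ symMap α β h ≫ _ = _
      rw [← Category.assoc, symIncl_map, Category.assoc, symIncl_desc]
      exact s.condition
    · change symDesc φ' s.inl δ hadd hmul hmap' (symMap α β h (symD φ b)) = _
      rw [symMap_d, symDesc_d]
      exact hd b
  · suffices H : ∀ m : symAlg φ' ⟶ s.pt, symIncl φ' ≫ m = s.inl → symMap α β h ≫ m = s.inr →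
        m = symDesc φ' s.inl δ hadd hmul hmap' from fun {m} hm₁ hm₂ ↦ H m hm₁ hm₂
    intro m hm₁ hm₂
    have hm₃ (b : B') : m (symIncl φ' b) = s.inl b := ConcreteCategory.congr_hom hm₁ b
    refine symAlg_hom_ext (hm₁.trans (symIncl_desc ..).symm) fun b ↦ ?_
    rw [symDesc_d, ← sub_eq_zero]
    refine eq_zero_of_formallyUnramified (α := β) (by algebraize [β.hom]; exact ⟨inferInstance⟩)
      s.inl (fun b ↦ m (symD φ' b) - δ b) ?_ ?_ ?_ b
    · intro b b'
      simp only [symD_add, map_add, δ, hadd]; ring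
    · intro b b'
      simp only [symD_mul, map_add, map_mul, δ, hmul, hm₃]; ring
    · intro b
      have h₁ : m (symD φ' (β b)) = s.inr (symD φ b) := by
        rw [← symMap_d α β h, ← hm₂]; rfl
      simp only [h₁, δ, hd, sub_self]
end

end Algebra

variable {X S : Scheme.{u}}

lemma appLE_id (U : X.Opens) (h : U ≤ 𝟙 X ⁻¹ᵁ U) : (𝟙 X : X ⟶ X).appLE U U h = 𝟙 _ := by
  simp only [Scheme.Hom.appLE, Scheme.Hom.id_app]
  exact (Category.id_comp _).trans (X.presheaf.map_id _)

/-- A chart of a morphism `f : X ⟶ S`: an affine open `U` of `X` and an affine open `V` of `S`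
with `f(U) ⊆ V`. -/
structure Chart (f : X ⟶ S) where
  U : X.Opens
  V : S.Opens
  hU : IsAffineOpen U
  hV : IsAffineOpen V
  le : U ≤ f ⁻¹ᵁ V

namespace Chart

instance (f : X ⟶ S) : Preorder (Chart f) where
  le c c' := c.U ≤ c'.U ∧ c.V ≤ c'.V
  le_refl _ := ⟨le_rfl, le_rfl⟩
  le_trans _ _ _ h h' := ⟨h.1.trans h'.1, h.2.trans h'.2⟩

lemma leU {f : X ⟶ S} {c c' : Chart f} (h : c ≤ c') : c.U ≤ 𝟙 X ⁻¹ᵁ c'.U := h.1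

lemma leV {f : X ⟶ S} {c c' : Chart f} (h : c ≤ c') : c.V ≤ 𝟙 S ⁻¹ᵁ c'.V := h.2

/-- The ring map `Γ(S, V) ⟶ Γ(X, U)` of a chart. -/
abbrev ring {f : X ⟶ S} (c : Chart f) : Γ(S, c.V) ⟶ Γ(X, c.U) := f.appLE c.V c.U c.le

/-- The tangent scheme `Spec (Sym (Ω¹_{Γ(X, U)/Γ(S, V)}))` of a chart. -/
abbrev tangent {f : X ⟶ S} (c : Chart f) : Scheme.{u} := Spec (symAlg c.ring)

lemma exists_mem (f : X ⟶ S) (x : X) (W : X.Opens) (hxW : x ∈ W) (W' : S.Opens)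
    (hxW' : f x ∈ W') : ∃ c : Chart f, x ∈ c.U ∧ c.U ≤ W ∧ c.V ≤ W' := by
  obtain ⟨_, ⟨V, hV, rfl⟩, hxV, hVW⟩ :=
    S.isBasis_affineOpens.exists_subset_of_mem_open hxW' W'.2
  obtain ⟨_, ⟨U, hU, rfl⟩, hxU, hUW⟩ :=
    X.isBasis_affineOpens.exists_subset_of_mem_open
      (show x ∈ W ⊓ f ⁻¹ᵁ V from ⟨hxW, hxV⟩) (W ⊓ f ⁻¹ᵁ V).2
  exact ⟨⟨U, V, hU, hV, fun y hy ↦ (hUW hy).2⟩, hxU, fun y hy ↦ (hUW hy).1, hVW⟩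

section map

variable {X' S' : Scheme.{u}} {f' : X' ⟶ S'} {f : X ⟶ S}

/-- For a commutative square `(g, s) : f' ⟶ f`, charts `c'` of `f'` and `c` of `f` with
`g(U') ⊆ U` and `s(V') ⊆ V`, the map
`Spec (Sym (Ω¹_{Γ(X', U')/Γ(S', V')})) ⟶ Spec (Sym (Ω¹_{Γ(X, U)/Γ(S, V)}))`
given by `b ↦ g^♯ b`, `db ↦ d(g^♯ b)`. -/
def map (g : X' ⟶ X) (s : S' ⟶ S) (sq : f' ≫ s = g ≫ f) (c' : Chart f') (c : Chart f)
    (hU : c'.U ≤ g ⁻¹ᵁ c.U) (hV : c'.V ≤ s ⁻¹ᵁ c.V) : c'.tangent ⟶ c.tangent :=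
  Spec.map (symMap (s.appLE c.V c'.V hV) (g.appLE c.U c'.U hU)
    (by simp only [ring, Scheme.Hom.appLE_comp_appLE, sq]))

/-- The projection `Spec (Sym (Ω¹_{Γ(X, U)/Γ(S, V)})) ⟶ Spec Γ(X, U)`. -/
abbrev proj (c : Chart f) : c.tangent ⟶ Spec Γ(X, c.U) := Spec.map (symIncl c.ring)

lemma map_proj (g : X' ⟶ X) (s : S' ⟶ S) (sq : f' ≫ s = g ≫ f) (c' : Chart f') (c : Chart f)
    (hU : c'.U ≤ g ⁻¹ᵁ c.U) (hV : c'.V ≤ s ⁻¹ᵁ c.V) :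
    map g s sq c' c hU hV ≫ c.proj = c'.proj ≫ Spec.map (g.appLE c.U c'.U hU) := by
  simp only [map, proj, ← Spec.map_comp, symIncl_map]

lemma map_id (c : Chart f) (sq hU hV) : map (𝟙 X) (𝟙 S) sq c c hU hV = 𝟙 c.tangent := by
  simp only [map]
  rw [← Spec.map_id]
  congr 1
  refine symAlg_hom_ext ?_ ?_ <;> simp [appLE_id]

lemma map_comp {X'' S'' : Scheme.{u}} {f'' : X'' ⟶ S''} (g' : X'' ⟶ X') (s' : S'' ⟶ S') (sq')
    (g : X' ⟶ X) (s : S' ⟶ S) (sq) (c'' : Chart f'') (c' : Chart f') (c : Chart f)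
    (hU' hV' hU hV) {h : X'' ⟶ X} {t : S'' ⟶ S} (hh : h = g' ≫ g) (ht : t = s' ≫ s)
    (sq'') (hU'') (hV'') :
    map g' s' sq' c'' c' hU' hV' ≫ map g s sq c' c hU hV = map h t sq'' c'' c hU'' hV'' := by
  subst hh ht
  simp only [map, ← Spec.map_comp]
  congr 1
  refine symAlg_hom_ext ?_ ?_
  · simp [Scheme.Hom.appLE_comp_appLE_assoc]
  · intro b
    simp [← Scheme.Hom.appLE_comp_appLE _ _ c.U c'.U c''.U hU hU']

lemma map_comp_assoc {X'' S'' : Scheme.{u}} {f'' : X'' ⟶ S''} (g' : X'' ⟶ X') (s' : S'' ⟶ S')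
    (sq') (g : X' ⟶ X) (s : S' ⟶ S) (sq) (c'' : Chart f'') (c' : Chart f') (c : Chart f)
    (hU' hV' hU hV) {h : X'' ⟶ X} {t : S'' ⟶ S} (hh : h = g' ≫ g) (ht : t = s' ≫ s)
    (sq'') (hU'') (hV'') {Z : Scheme.{u}} (q : c.tangent ⟶ Z) :
    map g' s' sq' c'' c' hU' hV' ≫ map g s sq c' c hU hV ≫ q =
      map h t sq'' c'' c hU'' hV'' ≫ q := by
  rw [← Category.assoc, map_comp g' s' sq' g s sq c'' c' c hU' hV' hU hV hh ht sq'' hU'' hV'']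

end map

/-- The charts of `f : X ⟶ S` cover `X`. -/
abbrev cover (f : X ⟶ S) : X.OpenCover where
  I₀ := Chart f
  X c := Spec Γ(X, c.U)
  f c := c.hU.fromSpec
  mem₀ := by
    rw [Scheme.presieve₀_mem_precoverage_iff]
    refine ⟨fun x ↦ ?_, fun c ↦ c.hU.isOpenImmersion_fromSpec⟩
    obtain ⟨c, hc, -, -⟩ := exists_mem f x ⊤ trivial ⊤ trivial
    refine ⟨c, ?_⟩
    rw [c.hU.range_fromSpec]
    exact hc

instance (f : X ⟶ S) : Small.{u} (Chart f) := by
  let i : Chart f → X.Opens × S.Opens := fun c ↦ (c.U, c.V)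
  have : Function.Injective i := by
    rintro ⟨U, V, _, _, _⟩ ⟨U', V', _, _, _⟩ h
    obtain ⟨rfl, rfl⟩ := Prod.mk.inj h
    rfl
  exact small_of_injective this

/-- The transition map `Spec Γ(X, U) ⟶ Spec Γ(X, U')` for `U ⊆ U'`. -/
def trans {f : X ⟶ S} {c c' : Chart f} (h : c ≤ c') : Spec Γ(X, c.U) ⟶ Spec Γ(X, c'.U) :=
  Spec.map ((𝟙 X : X ⟶ X).appLE c'.U c.U (leU h))

lemma trans_fromSpec {f : X ⟶ S} {c c' : Chart f} (h : c ≤ c') :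
    trans h ≫ c'.hU.fromSpec = c.hU.fromSpec := by
  exact (IsAffineOpen.SpecMap_appLE_fromSpec (𝟙 X) c'.hU c.hU (leU h)).trans (Category.comp_id _)

instance {f : X ⟶ S} {c c' : Chart f} (h : c ≤ c') : IsOpenImmersion (trans h) := by
  have : IsOpenImmersion (trans h ≫ c'.hU.fromSpec) := by
    rw [trans_fromSpec]; exact c.hU.isOpenImmersion_fromSpec
  exact IsOpenImmersion.of_comp _ c'.hU.fromSpec

instance (f : X ⟶ S) : (cover f).LocallyDirected where
  trans {c c'} h := trans (f := f) (c := c) (c' := c') (leOfHom h)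
  trans_id c := by rw [trans, appLE_id, Spec.map_id]
  trans_comp {c c' c''} h h' := by
    simp only [trans, ← Spec.map_comp]
    rw [Scheme.Hom.appLE_comp_appLE]
    congr 1
  w {c c'} h := trans_fromSpec _
  directed {c c'} x := by
    dsimp at x ⊢
    let a : X := (pullback.fst c.hU.fromSpec c'.hU.fromSpec ≫ c.hU.fromSpec) x
    have haU : a ∈ c.U := by
      rw [← SetLike.mem_coe, ← c.hU.range_fromSpec]
      exact ⟨pullback.fst c.hU.fromSpec c'.hU.fromSpec x, by simp [a]⟩
    have haU' : a ∈ c'.U := by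
      rw [← SetLike.mem_coe, ← c'.hU.range_fromSpec]
      exact ⟨pullback.snd c.hU.fromSpec c'.hU.fromSpec x, by
        simp only [a]; rw [pullback.condition]; simp⟩
    obtain ⟨k, hak, hkU, hkV⟩ := exists_mem f a (c.U ⊓ c'.U) ⟨haU, haU'⟩ (c.V ⊓ c'.V)
      ⟨c.le haU, c'.le haU'⟩
    have hk : k ≤ c := ⟨hkU.trans inf_le_left, hkV.trans inf_le_left⟩
    have hk' : k ≤ c' := ⟨hkU.trans inf_le_right, hkV.trans inf_le_right⟩
    rw [← SetLike.mem_coe, ← k.hU.range_fromSpec] at hak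
    obtain ⟨y, hy⟩ := hak
    refine ⟨k, homOfLE hk, homOfLE hk', y, ?_⟩
    apply (pullback.fst c.hU.fromSpec c'.hU.fromSpec ≫ c.hU.fromSpec).isOpenEmbedding.injective
    rw [← Scheme.Hom.comp_apply, pullback.lift_fst_assoc, trans_fromSpec]
    exact hy
  property_trans {c c'} h := inferInstanceAs (IsOpenImmersion (trans (leOfHom h)))

lemma isPullback_map {f : X ⟶ S} {c c' : Chart f} (h : c ≤ c') :
    IsPullback (map (𝟙 X) (𝟙 S) (by simp) c c' (Chart.leU h) (Chart.leV h)) c.proj c'.proj (trans h) := by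
  refine (isPullback_SpecMap_of_isPushout _ _ _ _ (isPushout_symMap _ _ _ ?_ ?_)).flip
  · exact (𝟙 S : S ⟶ S).formallyUnramified_appLE c'.hV c.hV (leV h)
  · have := (𝟙 X : X ⟶ X).etale_appLE c'.hU c.hU (leU h)
    algebraize [((𝟙 X : X ⟶ X).appLE c'.U c.U (leU h)).hom]
    exact this.formallyEtale

end Chart

/-- The gluing datum of the schemes `Spec (Sym (Ω¹_{Γ(X, U)/Γ(S, V)}))`, for all charts of `f`. -/
def gluingData (f : X ⟶ S) : (Chart.cover f).RelativeGluingData where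
  functor :=
    { obj c := Chart.tangent (f := f) c
      map {c c'} h := Chart.map (𝟙 X) (𝟙 S) (by simp) c c' (Chart.leU (leOfHom h)) (Chart.leV (leOfHom h))
      map_id c := Chart.map_id ..
      map_comp h h' := (Chart.map_comp _ _ _ _ _ _ _ _ _ _ _ _ _ (by simp) (by simp) _ _ _).symm }
  natTrans :=
    { app c := Chart.proj c
      naturality c c' h := (Chart.isPullback_map (leOfHom h)).w }
  equifibered c c' h := Chart.isPullback_map (leOfHom h)

instance (f : X ⟶ S) : ((gluingData f).functor ⋙ Scheme.forget).IsLocallyDirected :=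
  Scheme.Cover.RelativeGluingData.instIsLocallyDirectedI₀CompFunctorForgetOfIsThin ..

/-- The relative tangent scheme `T_{X/S} = Spec (Sym (Ω¹_{X/S}))` of `f : X ⟶ S`, glued from the
affine schemes `Spec (Sym (Ω¹_{Γ(X, U)/Γ(S, V)}))`, where `U ⊆ X` and `V ⊆ S` are affine open with
`f(U) ⊆ V`. -/
def tangent (f : X ⟶ S) : Scheme.{u} := (gluingData f).glued

/-- The projection `T_{X/S} ⟶ X`. -/
def tangentProj (f : X ⟶ S) : tangent f ⟶ X := (gluingData f).toBase

/-- The inclusion `Spec (Sym (Ω¹_{Γ(X, U)/Γ(S, V)})) ⟶ T_{X/S}` of a chart. -/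
def tangentι {f : X ⟶ S} (c : Chart f) : c.tangent ⟶ tangent f :=
  colimit.ι (gluingData f).functor c

instance {f : X ⟶ S} (c : Chart f) : IsOpenImmersion (tangentι c) :=
  (gluingData f).cover.map_prop c

lemma tangentι_proj {f : X ⟶ S} (c : Chart f) :
    tangentι c ≫ tangentProj f = c.proj ≫ c.hU.fromSpec :=
  (gluingData f).ι_toBase c

/-- Over `U`, the scheme `T_{X/S}` is `Spec (Sym (Ω¹_{Γ(X, U)/Γ(S, V)}))`. -/
lemma isPullback_tangentι {f : X ⟶ S} (c : Chart f) :
    IsPullback c.proj (tangentι c) c.hU.fromSpec (tangentProj f) :=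
  (gluingData f).isPullback_natTrans_ι_toBase c

lemma map_tangentι {f : X ⟶ S} {c c' : Chart f} (h : c ≤ c') :
    Chart.map (𝟙 X) (𝟙 S) (by simp) c c' (Chart.leU h) (Chart.leV h) ≫ tangentι c' = tangentι c :=
  colimit.w (gluingData f).functor (homOfLE h)

lemma mem_opensRange_tangentι {f : X ⟶ S} (c : Chart f) (t : tangent f) :
    t ∈ (tangentι c).opensRange ↔ tangentProj f t ∈ c.U := by
  have := (gluingData f).toBase_preimage_eq_opensRange_ι c
  rw [show ((Chart.cover f).f c).opensRange = c.U from c.hU.opensRange_fromSpec] at this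
  exact (iff_of_eq congr(t ∈ $this)).symm

section map

variable {X' S' : Scheme.{u}} {f' : X' ⟶ S'} {f : X ⟶ S} (g : X' ⟶ X) (s : S' ⟶ S)
  (sq : f' ≫ s = g ≫ f)

/-- Morphisms out of `T_{X/S}` may be compared on sufficiently many charts. -/
lemma tangent_hom_ext {Z : Scheme.{u}} {p q : tangent f ⟶ Z}
    (h : ∀ x : X, ∃ c : Chart f, x ∈ c.U ∧ tangentι c ≫ p = tangentι c ≫ q) : p = q := by
  refine Scheme.hom_ext_of_forall _ _ fun t ↦ ?_
  obtain ⟨c, hc, hpq⟩ := h (tangentProj f t)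
  refine ⟨(tangentι c).opensRange, (mem_opensRange_tangentι c t).mpr hc, ?_⟩
  rw [← cancel_epi (tangentι c).isoOpensRange.hom]
  simpa using hpq

/-- A pair of compatible charts of the two sides of a commutative square. -/
structure ChartPair where
  src : Chart f'
  tgt : Chart f
  hU : src.U ≤ g ⁻¹ᵁ tgt.U
  hV : src.V ≤ s ⁻¹ᵁ tgt.V

namespace ChartPair

variable {g s}

instance : Preorder (ChartPair (f' := f') (f := f) g s) where
  le c c' := c.src ≤ c'.src ∧ c.tgt ≤ c'.tgt
  le_refl _ := ⟨le_rfl, le_rfl⟩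
  le_trans _ _ _ h h' := ⟨h.1.trans h'.1, h.2.trans h'.2⟩

lemma exists_mem (sq : f' ≫ s = g ≫ f) (x : X') (W : Chart f') (hW : x ∈ W.U) (Z : Chart f) (hZ : g x ∈ Z.U) :
    ∃ c : ChartPair (f' := f') (f := f) g s, x ∈ c.src.U ∧ c.src ≤ W ∧ c.tgt ≤ Z := by
  have hx : s (f' x) ∈ Z.V := by
    rw [← Scheme.Hom.comp_apply, sq, Scheme.Hom.comp_apply]
    exact Z.le hZ
  obtain ⟨c, hxc, hcU, hcV⟩ := Chart.exists_mem f' x (W.U ⊓ g ⁻¹ᵁ Z.U) ⟨hW, hZ⟩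
    (W.V ⊓ s ⁻¹ᵁ Z.V) ⟨W.le hW, hx⟩
  exact ⟨⟨c, Z, hcU.trans inf_le_right, hcV.trans inf_le_right⟩, hxc,
    ⟨hcU.trans inf_le_left, hcV.trans inf_le_left⟩, le_rfl⟩

lemma exists_mem' (sq : f' ≫ s = g ≫ f) (x : X') : ∃ c : ChartPair (f' := f') (f := f) g s, x ∈ c.src.U := by
  obtain ⟨W, hW, -, -⟩ := Chart.exists_mem f' x ⊤ trivial ⊤ trivial
  obtain ⟨Z, hZ, -, -⟩ := Chart.exists_mem f (g x) ⊤ trivial ⊤ trivial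
  obtain ⟨c, hc, -, -⟩ := exists_mem sq x W hW Z hZ
  exact ⟨c, hc⟩

/-- The cover of `T_{X'/S'}` by the sources of all pairs of compatible charts. -/
abbrev cover : (tangent f').OpenCover where
  I₀ := ChartPair (f' := f') (f := f) g s
  X c := c.src.tangent
  f c := tangentι c.src
  mem₀ := by
    rw [Scheme.presieve₀_mem_precoverage_iff]
    refine ⟨fun t ↦ ?_, fun c ↦ inferInstance⟩
    obtain ⟨c, hc⟩ := exists_mem' sq (tangentProj f' t)
    exact ⟨c, (mem_opensRange_tangentι c.src t).mpr hc⟩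

instance : (cover sq).LocallyDirected where
  trans {c c'} h := Chart.map (𝟙 X') (𝟙 S') (by simp) c.src c'.src
    (Chart.leU (leOfHom h).1) (Chart.leV (leOfHom h).1)
  trans_id c := Chart.map_id ..
  trans_comp h h' := (Chart.map_comp _ _ _ _ _ _ _ _ _ _ _ _ _ (by simp) (by simp) _ _ _).symm
  w {c c'} h := map_tangentι (leOfHom h).1
  directed {c c'} t := by
    dsimp at t ⊢
    let a : tangent f' := (pullback.fst (tangentι c.src) (tangentι c'.src) ≫ tangentι c.src) t
    have ha : tangentProj f' a ∈ c.src.U := by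
      rw [← mem_opensRange_tangentι]
      exact ⟨pullback.fst (tangentι c.src) (tangentι c'.src) t, by simp [a]⟩
    have ha' : tangentProj f' a ∈ c'.src.U := by
      rw [← mem_opensRange_tangentι]
      exact ⟨pullback.snd (tangentι c.src) (tangentι c'.src) t, by
        simp only [a]; rw [pullback.condition]; simp⟩
    obtain ⟨W, hW, hWU, hWV⟩ := Chart.exists_mem f' (tangentProj f' a) (c.src.U ⊓ c'.src.U)
      ⟨ha, ha'⟩ (c.src.V ⊓ c'.src.V) ⟨c.src.le ha, c'.src.le ha'⟩
    obtain ⟨Z, hZ, hZU, hZV⟩ := Chart.exists_mem f (g (tangentProj f' a)) (c.tgt.U ⊓ c'.tgt.U)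
      ⟨c.hU ha, c'.hU ha'⟩ (c.tgt.V ⊓ c'.tgt.V) ⟨c.tgt.le (c.hU ha), c'.tgt.le (c'.hU ha')⟩
    obtain ⟨k, hk, hkW, hkZ⟩ := exists_mem sq (tangentProj f' a) W hW Z hZ
    have h : k ≤ c := ⟨hkW.trans ⟨hWU.trans inf_le_left, hWV.trans inf_le_left⟩,
      hkZ.trans ⟨hZU.trans inf_le_left, hZV.trans inf_le_left⟩⟩
    have h' : k ≤ c' := ⟨hkW.trans ⟨hWU.trans inf_le_right, hWV.trans inf_le_right⟩,
      hkZ.trans ⟨hZU.trans inf_le_right, hZV.trans inf_le_right⟩⟩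
    obtain ⟨y, hy⟩ := (mem_opensRange_tangentι k.src a).mpr hk
    refine ⟨k, homOfLE h, homOfLE h', y, ?_⟩
    apply (pullback.fst (tangentι c.src) (tangentι c'.src) ≫
      tangentι c.src).isOpenEmbedding.injective
    rw [← Scheme.Hom.comp_apply, pullback.lift_fst_assoc, map_tangentι h.1]
    exact hy
  property_trans {c c'} h := by
    have : IsOpenImmersion (Chart.map (𝟙 X') (𝟙 S') (by simp) c.src c'.src
        (Chart.leU (leOfHom h).1) (Chart.leV (leOfHom h).1) ≫ tangentι c'.src) := by
      rw [map_tangentι (leOfHom h).1]; infer_instance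
    exact IsOpenImmersion.of_comp _ (tangentι c'.src)

end ChartPair

lemma tangentMap_aux {c c' : ChartPair (f' := f') (f := f) g s} (h : c ≤ c') :
    Chart.map (𝟙 X') (𝟙 S') (by simp) c.src c'.src (Chart.leU h.1) (Chart.leV h.1) ≫
      Chart.map g s sq c'.src c'.tgt c'.hU c'.hV ≫ tangentι c'.tgt =
      Chart.map g s sq c.src c.tgt c.hU c.hV ≫ tangentι c.tgt := by
  have hU : c.src.U ≤ g ⁻¹ᵁ c'.tgt.U := c.hU.trans (fun x hx ↦ h.2.1 hx)
  have hV : c.src.V ≤ s ⁻¹ᵁ c'.tgt.V := c.hV.trans (fun x hx ↦ h.2.2 hx)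
  rw [Chart.map_comp_assoc (𝟙 X') (𝟙 S') (by simp) g s sq c.src c'.src c'.tgt
    (Chart.leU h.1) (Chart.leV h.1) c'.hU c'.hV (h := g) (t := s) (by simp) (by simp) sq hU hV,
    ← map_tangentι h.2, Chart.map_comp_assoc g s sq (𝟙 X) (𝟙 S) (by simp) c.src c.tgt c'.tgt
    c.hU c.hV (Chart.leU h.2) (Chart.leV h.2) (h := g) (t := s) (by simp) (by simp) sq hU hV]

/-- A commutative square `(g, s)` from `X' ⟶ S'` to `X ⟶ S` induces the morphism
`T_{X'/S'} ⟶ T_{X/S}` which on compatible charts is given by `b ↦ g^♯ b`, `db ↦ d(g^♯ b)`. -/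
def tangentMap : tangent f' ⟶ tangent f :=
  (ChartPair.cover sq).glueMorphismsOfLocallyDirected
    (fun c ↦ Chart.map g s sq c.src c.tgt c.hU c.hV ≫ tangentι c.tgt)
    fun h ↦ tangentMap_aux g s sq (leOfHom h)

lemma tangentι_map (c' : Chart f') (c : Chart f) (hU : c'.U ≤ g ⁻¹ᵁ c.U)
    (hV : c'.V ≤ s ⁻¹ᵁ c.V) :
    tangentι c' ≫ tangentMap g s sq = Chart.map g s sq c' c hU hV ≫ tangentι c :=
  (ChartPair.cover sq).map_glueMorphismsOfLocallyDirected
    (fun c ↦ Chart.map g s sq c.src c.tgt c.hU c.hV ≫ tangentι c.tgt)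
    (fun h ↦ tangentMap_aux g s sq (leOfHom h))
    (⟨c', c, hU, hV⟩ : ChartPair (f' := f') (f := f) g s)

lemma tangentι_map_assoc (c' : Chart f') (c : Chart f) (hU : c'.U ≤ g ⁻¹ᵁ c.U)
    (hV : c'.V ≤ s ⁻¹ᵁ c.V) {Z : Scheme.{u}} (q : tangent f ⟶ Z) :
    tangentι c' ≫ tangentMap g s sq ≫ q = Chart.map g s sq c' c hU hV ≫ tangentι c ≫ q := by
  rw [← Category.assoc, tangentι_map g s sq c' c hU hV, Category.assoc]

lemma tangentMap_proj : tangentMap g s sq ≫ tangentProj f = tangentProj f' ≫ g := by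
  refine tangent_hom_ext fun x ↦ ?_
  obtain ⟨c, hc⟩ := ChartPair.exists_mem' sq x
  refine ⟨c.src, hc, ?_⟩
  rw [tangentι_map_assoc g s sq _ _ c.hU c.hV, tangentι_proj, ← Category.assoc, Chart.map_proj,
    Category.assoc, IsAffineOpen.SpecMap_appLE_fromSpec _ c.tgt.hU c.src.hU, ← Category.assoc,
    ← tangentι_proj, Category.assoc]

lemma tangentMap_proj_assoc {Z : Scheme.{u}} (q : X ⟶ Z) :
    tangentMap g s sq ≫ tangentProj f ≫ q = tangentProj f' ≫ g ≫ q := by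
  rw [← Category.assoc, tangentMap_proj, Category.assoc]

lemma tangentMap_id (sq) : tangentMap (f' := f) (f := f) (𝟙 X) (𝟙 S) sq = 𝟙 _ := by
  refine tangent_hom_ext fun x ↦ ?_
  obtain ⟨c, hc, -, -⟩ := Chart.exists_mem f x ⊤ trivial ⊤ trivial
  refine ⟨c, hc, ?_⟩
  rw [tangentι_map _ _ _ c c (Chart.leU le_rfl) (Chart.leV le_rfl), Chart.map_id]
  simp

lemma tangentMap_comp {X'' S'' : Scheme.{u}} {f'' : X'' ⟶ S''} (g' : X'' ⟶ X') (s' : S'' ⟶ S')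
    (sq' : f'' ≫ s' = g' ≫ f') {h : X'' ⟶ X} {t : S'' ⟶ S} (hh : h = g' ≫ g) (ht : t = s' ≫ s)
    (sq'' : f'' ≫ t = h ≫ f) :
    tangentMap g' s' sq' ≫ tangentMap g s sq = tangentMap h t sq'' := by
  subst hh ht
  refine tangent_hom_ext fun x ↦ ?_
  obtain ⟨c, hc⟩ := ChartPair.exists_mem' sq (g' x)
  obtain ⟨Z, hZ, -, -⟩ := Chart.exists_mem f'' x ⊤ trivial ⊤ trivial
  obtain ⟨d, hd, -, hdc⟩ := ChartPair.exists_mem sq' x Z hZ c.src hc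
  refine ⟨d.src, hd, ?_⟩
  have hU : d.tgt.U ≤ g ⁻¹ᵁ c.tgt.U := hdc.1.trans c.hU
  have hV : d.tgt.V ≤ s ⁻¹ᵁ c.tgt.V := hdc.2.trans c.hV
  have hU' : d.src.U ≤ (g' ≫ g) ⁻¹ᵁ c.tgt.U := fun y hy ↦ hU (d.hU hy)
  have hV' : d.src.V ≤ (s' ≫ s) ⁻¹ᵁ c.tgt.V := fun y hy ↦ hV (d.hV hy)
  rw [tangentι_map_assoc _ _ sq' _ _ d.hU d.hV, tangentι_map _ _ sq _ _ hU hV,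
    tangentι_map _ _ sq'' _ _ hU' hV',
    Chart.map_comp_assoc g' s' sq' g s sq _ _ _ _ _ _ _ rfl rfl sq'' hU' hV']

end map

/-- The relative tangent functor of `S`, sending `Z` over `S` to `T_{Z/S}`. -/
def tangentFunctor (S : Scheme.{u}) : Over S ⥤ Over S where
  obj Z := Over.mk (tangentProj Z.hom ≫ Z.hom)
  map {Z W} g := Over.homMk (tangentMap g.left (𝟙 S) (by simp)) (by
    simp [tangentMap_proj_assoc])
  map_id Z := by
    ext1
    exact tangentMap_id _
  map_comp {Z W V} g h := by
    ext1
    exact (tangentMap_comp _ _ _ _ _ _ (by simp) (by simp) _).symm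

section baseChange

variable {X Y : Scheme.{u}} (f : X ⟶ Y)

/-- The canonical base change morphism `T_{Z ×_Y X / X} ⟶ T_{Z/Y} ×_Y X`, for `h : Z ⟶ Y`: its
first component is induced by the projection `Z ×_Y X ⟶ Z` over `f : X ⟶ Y`. -/
def baseChangeLeft {Z : Scheme.{u}} (h : Z ⟶ Y) :
    tangent (pullback.snd h f) ⟶ pullback (tangentProj h ≫ h) f :=
  pullback.lift (tangentMap (pullback.fst h f) f pullback.condition.symm)
    (tangentProj (pullback.snd h f) ≫ pullback.snd h f)
    (by rw [tangentMap_proj_assoc, Category.assoc, pullback.condition])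

@[simp]
lemma baseChangeLeft_fst {Z : Scheme.{u}} (h : Z ⟶ Y) :
    baseChangeLeft f h ≫ pullback.fst _ _ =
      tangentMap (pullback.fst h f) f pullback.condition.symm :=
  pullback.lift_fst _ _ _

@[simp]
lemma baseChangeLeft_snd {Z : Scheme.{u}} (h : Z ⟶ Y) :
    baseChangeLeft f h ≫ pullback.snd _ _ =
      tangentProj (pullback.snd h f) ≫ pullback.snd h f :=
  pullback.lift_snd _ _ _

lemma baseChangeLeft_naturality {Z W : Scheme.{u}} (z : Z ⟶ Y) (w : W ⟶ Y) (h : Z ⟶ W)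
    (hw : h ≫ w = z) (k : pullback z f ⟶ pullback w f)
    (hk : k ≫ pullback.fst w f = pullback.fst z f ≫ h)
    (hk' : k ≫ pullback.snd w f = pullback.snd z f)
    (l : pullback (tangentProj z ≫ z) f ⟶ pullback (tangentProj w ≫ w) f) (sq)
    (hl : l ≫ pullback.fst _ _ = pullback.fst _ _ ≫ tangentMap (f' := z) (f := w) h (𝟙 Y) sq)
    (hl' : l ≫ pullback.snd _ _ = pullback.snd _ _) (sq') :
    tangentMap (f' := pullback.snd z f) (f := pullback.snd w f) k (𝟙 X) sq' ≫
      baseChangeLeft f w = baseChangeLeft f z ≫ l := by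
  refine pullback.hom_ext ?_ ?_
  · rw [Category.assoc, Category.assoc, baseChangeLeft_fst, hl, ← Category.assoc (baseChangeLeft f z), baseChangeLeft_fst]
    rw [tangentMap_comp (h := pullback.fst z f ≫ h) (t := f) _ _ _ _ _ _ hk.symm (by simp)
      (by rw [Category.assoc, hw, pullback.condition]),
      tangentMap_comp (h := pullback.fst z f ≫ h) (t := f) _ _ _ _ _ _ rfl (by simp)
      (by rw [Category.assoc, hw, pullback.condition])]
  · rw [Category.assoc, Category.assoc, baseChangeLeft_snd, hl', baseChangeLeft_snd,
      tangentMap_proj_assoc, hk']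

/-- The canonical base change transformation from `T_{∙/X} ∘ f^*` to `f^* ∘ T_{∙/Y}`, which at
`Z` over `Y` is the canonical morphism `T_{Z ×_Y X / X} ⟶ T_{Z/Y} ×_Y X`. -/
def baseChange : Over.pullback f ⋙ tangentFunctor X ⟶ tangentFunctor Y ⋙ Over.pullback f where
  app Z := Over.homMk (baseChangeLeft f Z.hom) (pullback.lift_snd _ _ _)
  naturality {Z W} h := by
    ext1
    exact baseChangeLeft_naturality f Z.hom W.hom h.left (Over.w h) _ (pullback.lift_fst _ _ _)
      (pullback.lift_snd _ _ _) _ _ (pullback.lift_fst _ _ _) (pullback.lift_snd _ _ _) _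

end baseChange

section pseudofunctor

/-- The unit isomorphism `Z ×_X X ≅ Z` of the pullback functors. -/
def pullbackUnit (X : Scheme.{u}) : Over.pullback (𝟙 X) ≅ 𝟭 (Over X) :=
  NatIso.ofComponents
    (fun Z ↦ Over.isoMk (asIso (pullback.fst Z.hom (𝟙 X)))
      (by simpa using pullback.condition (f := Z.hom) (g := 𝟙 X)))
    (fun {Z W} h ↦ by
      ext1
      exact pullback.lift_fst _ _ _)

@[simp]
lemma pullbackUnit_hom_app_left {X : Scheme.{u}} (Z : Over X) :
    ((pullbackUnit X).hom.app Z).left = pullback.fst Z.hom (𝟙 X) := rfl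

lemma compositor_naturality {X Y Z W W' : Scheme.{u}} (f : X ⟶ Y) (g : Y ⟶ Z) (w : W ⟶ Z)
    (w' : W' ⟶ Z) (h : W ⟶ W') (k : pullback (pullback.snd w g) f ⟶ pullback (pullback.snd w' g) f)
    (hk : k ≫ pullback.fst _ _ ≫ pullback.fst _ _ = pullback.fst _ _ ≫ pullback.fst _ _ ≫ h)
    (hk' : k ≫ pullback.snd _ _ = pullback.snd _ _)
    (l : pullback w (f ≫ g) ⟶ pullback w' (f ≫ g))
    (hl : l ≫ pullback.fst _ _ = pullback.fst _ _ ≫ h)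
    (hl' : l ≫ pullback.snd _ _ = pullback.snd _ _) :
    k ≫ (pullbackLeftPullbackSndIso w' g f).hom = (pullbackLeftPullbackSndIso w g f).hom ≫ l := by
  refine pullback.hom_ext ?_ ?_
  · simp [hk, hl]
  · simp [hk', hl']

/-- The compositor `f^*(g^* W) ≅ (g ∘ f)^* W` of the pullback functors, for `f : X ⟶ Y` and
`g : Y ⟶ Z`; it is the cancellation isomorphism `(W ×_Z Y) ×_Y X ≅ W ×_Z X`. -/
def compositor {X Y Z : Scheme.{u}} (f : X ⟶ Y) (g : Y ⟶ Z) :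
    Over.pullback g ⋙ Over.pullback f ≅ Over.pullback (f ≫ g) :=
  NatIso.ofComponents
    (fun W ↦ Over.isoMk (pullbackLeftPullbackSndIso W.hom g f)
      (pullbackLeftPullbackSndIso_hom_snd W.hom g f))
    (fun {W W'} h ↦ by
      ext1
      refine compositor_naturality f g W.hom W'.hom h.left _ ?_ (pullback.lift_snd _ _ _) _
        (pullback.lift_fst _ _ _) (pullback.lift_snd _ _ _)
      erw [pullback.lift_fst_assoc, Category.assoc, pullback.lift_fst]
      rfl)

@[simp]
lemma compositor_hom_app_left {X Y Z : Scheme.{u}} (f : X ⟶ Y) (g : Y ⟶ Z) (W : Over Z) :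
    ((compositor f g).hom.app W).left = (pullbackLeftPullbackSndIso W.hom g f).hom := rfl

@[simp]
lemma compositor_inv_app_left {X Y Z : Scheme.{u}} (f : X ⟶ Y) (g : Y ⟶ Z) (W : Over Z) :
    ((compositor f g).inv.app W).left = (pullbackLeftPullbackSndIso W.hom g f).inv := rfl

lemma eqToHom_pullback_left_fst {X Y : Scheme.{u}} {f f' : X ⟶ Y} (h : f = f')
    (hh : (Over.pullback f).toCatHom = (Over.pullback f').toCatHom) (W : Over Y) :
    ((eqToHom hh).toNatTrans.app W).left ≫ pullback.fst W.hom f' = pullback.fst W.hom f := by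
  subst h
  exact Category.id_comp _

lemma eqToHom_pullback_left_snd {X Y : Scheme.{u}} {f f' : X ⟶ Y} (h : f = f')
    (hh : (Over.pullback f).toCatHom = (Over.pullback f').toCatHom) (W : Over Y) :
    ((eqToHom hh).toNatTrans.app W).left ≫ pullback.snd W.hom f' = pullback.snd W.hom f := by
  subst h
  exact Category.id_comp _

lemma compositor_assoc {V W X Y Z : Scheme.{u}} (w : W ⟶ Z) (a : Y ⟶ Z) (b : X ⟶ Y) (c : V ⟶ X)
    (k : pullback (pullback.snd w (b ≫ a)) c ⟶ pullback (pullback.snd (pullback.snd w a) b) c)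
    (hk : k ≫ pullback.fst _ _ = pullback.fst _ _ ≫ (pullbackLeftPullbackSndIso w a b).inv)
    (hk' : k ≫ pullback.snd _ _ = pullback.snd _ _)
    (e : pullback w (c ≫ b ≫ a) ⟶ pullback w ((c ≫ b) ≫ a))
    (he : e ≫ pullback.fst _ _ = pullback.fst _ _)
    (he' : e ≫ pullback.snd _ _ = pullback.snd _ _) :
    (pullbackLeftPullbackSndIso w (b ≫ a) c).inv ≫ k ≫ 𝟙 _ ≫
      (pullbackLeftPullbackSndIso (pullback.snd w a) b c).hom ≫
        (pullbackLeftPullbackSndIso w a (c ≫ b)).hom = e := by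
  refine pullback.hom_ext ?_ ?_
  · simp [he, reassoc_of% hk]
  · simp [he', hk']

lemma pullbackUnit_left {W X Y : Scheme.{u}} (w : W ⟶ Y) (f : X ⟶ Y)
    (k : pullback (pullback.snd w (𝟙 Y)) f ⟶ pullback w f)
    (hk : k ≫ pullback.fst _ _ = pullback.fst _ _ ≫ pullback.fst _ _)
    (hk' : k ≫ pullback.snd _ _ = pullback.snd _ _)
    (e : pullback w (f ≫ 𝟙 Y) ⟶ pullback w f)
    (he : e ≫ pullback.fst _ _ = pullback.fst _ _)
    (he' : e ≫ pullback.snd _ _ = pullback.snd _ _) :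
    (pullbackLeftPullbackSndIso w (𝟙 Y) f).inv ≫ k ≫ 𝟙 _ = e := by
  refine pullback.hom_ext ?_ ?_
  · simp [he, hk]
  · simp [he', hk']

lemma pullbackUnit_right {W X Y : Scheme.{u}} (w : W ⟶ Y) (f : X ⟶ Y)
    (e : pullback w (𝟙 X ≫ f) ⟶ pullback w f)
    (he : e ≫ pullback.fst _ _ = pullback.fst _ _)
    (he' : e ≫ pullback.snd _ _ = pullback.snd _ _) :
    (pullbackLeftPullbackSndIso w f (𝟙 X)).inv ≫ pullback.fst _ _ ≫ 𝟙 _ = e := by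
  refine pullback.hom_ext ?_ ?_
  · simp [he]
  · simp only [he', Category.assoc, Category.id_comp]
    rw [pullbackLeftPullbackSndIso_inv_fst_snd, Category.comp_id]

/-- The pseudofunctor `Schᵒᵖ ⥤ Cat` with `X ↦ Sch/X` and `f ↦ f^*`, with the isomorphisms
`Z ×_X X ≅ Z` and `(W ×_Z Y) ×_Y X ≅ W ×_Z X` as its unitors and compositors. -/
def schOver : Pseudofunctor (LocallyDiscrete Scheme.{u}ᵒᵖ) Cat.{u, u + 1} :=
  LocallyDiscrete.mkPseudofunctor
    (fun X ↦ Cat.of (Over X.unop))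
    (fun f ↦ (Over.pullback f.unop).toCatHom)
    (fun X ↦ Cat.Hom.isoMk (pullbackUnit X.unop))
    (fun f g ↦ Cat.Hom.isoMk (compositor g.unop f.unop).symm)
    (fun f g h ↦ by
      ext W
      refine Over.OverMorphism.ext ?_
      exact compositor_assoc W.hom f.unop g.unop h.unop _ (pullback.lift_fst _ _ _)
        (pullback.lift_snd _ _ _) _
        (eqToHom_pullback_left_fst (by simp) _ W) (eqToHom_pullback_left_snd (by simp) _ W))
    (fun f ↦ by
      ext W
      refine Over.OverMorphism.ext ?_
      exact pullbackUnit_left W.hom f.unop _ (pullback.lift_fst _ _ _)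
        (pullback.lift_snd _ _ _) _
        (eqToHom_pullback_left_fst (by simp) _ W) (eqToHom_pullback_left_snd (by simp) _ W))
    (fun f ↦ by
      ext W
      refine Over.OverMorphism.ext ?_
      exact pullbackUnit_right W.hom f.unop _
        (eqToHom_pullback_left_fst (by simp) _ W) (eqToHom_pullback_left_snd (by simp) _ W))

/-- The components `app a` and the invertible cells `nat f` are those of a pseudonatural
transformation `F ⟹ G`. -/
def IsPseudonatural {B : Type*} [Bicategory B] {C : Type*} [Bicategory C] {F G : Pseudofunctor B C}
    (app : ∀ a : B, F.obj a ⟶ G.obj a)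
    (nat : ∀ (a b : B) (f : a ⟶ b), F.map f ≫ app b ≅ app a ≫ G.map f) : Prop :=
  ∃ σ : Pseudofunctor.StrongTrans F G,
    (⟨σ.app, fun _ _ f ↦ σ.naturality f⟩ : Σ' app : (∀ a : B, F.obj a ⟶ G.obj a),
      ∀ (a b : B) (f : a ⟶ b), F.map f ≫ app b ≅ app a ≫ G.map f) = ⟨app, nat⟩

end pseudofunctor

end RelTangent

end

/-! The geometric content is that relative tangent schemes commute with base change, and the
algebraic reason is dual numbers. Write `R[ε]` for the square-zero extension `TrivSqZeroExt R R`. A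
ring map `Sym_B(Ω¹_{B/A}) ⟶ R` is a ring map `p : B ⟶ R` with an `A`-linear derivation along `p`.
Equivalently, it is a ring map `p + εδ : B ⟶ R[ε]` whose restriction to `A` has no `ε`-part. If `B'
= B ⊗_A A'`, a map `B' ⟶ R[ε]` without `ε`-part on `A'` amounts to a map `B ⟶ R[ε]` and a map `A' ⟶
R` that agree on `A`. Comparing universal properties gives `Sym_{B'}(Ω¹_{B'/A'}) = B' ⊗_B
Sym_B(Ω¹_{B/A})`, which is `isPushout_symMap_of_isPushout`.

For a cartesian square of schemes, `X'` is covered by affine opens `U ×_V V'` with `U`, `V`, `V'`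
affine. The local statement therefore glues to `T_{X'/S'} = T_{X/S} ×_X X'`
(`isPullback_tangentMap`). Pasting with `X' = X ×_S S'` identifies this with `T_{X/S} ×_S S'`, so
the canonical base change map is an isomorphism.

The coherence laws need no further geometry. Maps into a fibre product are compared on both
projections: on the first, the functoriality `tangentMap_comp` makes both sides the tangent map of
one and the same projection; on the second, only structure morphisms occur. -/

noncomputable section

namespace RelTangent

/-! ### Dual numbers and base change of `Sym(Ω¹)` for rings -/

section Algebra

variable {A B : CommRingCat.{u}} {φ : A ⟶ B}

/-- The ring map `B ⟶ R[ε]`, `b ↦ p b + ε δ b`, attached to a derivation `δ` along `p`. -/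
def dualNumberMap {R : CommRingCat.{u}} (p : B ⟶ R) (δ : B → R) (hone : δ 1 = 0)
    (hadd : ∀ b b', δ (b + b') = δ b + δ b')
    (hmul : ∀ b b', δ (b * b') = p b * δ b' + p b' * δ b) :
    B ⟶ CommRingCat.of (TrivSqZeroExt R R) :=
  CommRingCat.ofHom
    { toFun b := TrivSqZeroExt.inl (p b) + TrivSqZeroExt.inr (δ b)
      map_one' := by ext <;> simp [hone]
      map_zero' := by
        have : δ 0 = 0 := by simpa using hadd 0 0
        ext <;> simp [this]
      map_add' b b' := by ext <;> simp [hadd]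
      map_mul' b b' := by ext <;> simp [hmul, mul_comm] }

lemma dualNumber_hom_ext {R : CommRingCat.{u}} {q q' : B ⟶ CommRingCat.of (TrivSqZeroExt R R)}
    (hfst : ∀ b, (q b).fst = (q' b).fst) (hsnd : ∀ b, (q b).snd = (q' b).snd) : q = q' :=
  CommRingCat.hom_ext (RingHom.ext fun b ↦ TrivSqZeroExt.ext (hfst b) (hsnd b))

/-- The ring map `B ⟶ R[ε]`, `b ↦ m b + ε m (db)`, attached to a ring map `m` out of
`Sym_B(Ω¹_{B/A})`. -/
def symDualNumberMap {R : CommRingCat.{u}} (m : symAlg φ ⟶ R) :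
    B ⟶ CommRingCat.of (TrivSqZeroExt R R) :=
  dualNumberMap (symIncl φ ≫ m) (fun b ↦ m (symD φ b))
    (by simpa using congr(m $(symD_map φ 1))) (by simp [symD_add]) (by simp [symD_mul])

section
variable {R : CommRingCat.{u}} (m : symAlg φ ⟶ R)

lemma fst_symDualNumberMap (b : B) : (symDualNumberMap m b).fst = m (symIncl φ b) := by
  simp [symDualNumberMap, dualNumberMap]

lemma snd_symDualNumberMap (b : B) : (symDualNumberMap m b).snd = m (symD φ b) := by
  simp [symDualNumberMap, dualNumberMap]

/-- The two coefficients recover `m` on `B` and on the elements `db`, which together generate the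
symmetric algebra. This is the uniqueness half of the universal property in terms of `R[ε]`. -/
lemma symDualNumberMap_injective {m m' : symAlg φ ⟶ R}
    (h : symDualNumberMap m = symDualNumberMap m') : m = m' := by
  have h (b : B) : symDualNumberMap m b = symDualNumberMap m' b := by rw [h]
  refine symAlg_hom_ext ?_ fun b ↦ ?_
  · ext b
    have := congr(($(h b)).fst)
    rwa [fst_symDualNumberMap, fst_symDualNumberMap] at this
  · have := congr(($(h b)).snd)
    rwa [snd_symDualNumberMap, snd_symDualNumberMap] at this

/-- The structure map `R ⟶ R[ε]`. -/
def dualNumberInl (R : CommRingCat.{u}) : R ⟶ CommRingCat.of (TrivSqZeroExt R R) :=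
  CommRingCat.ofHom (TrivSqZeroExt.inlHom R R)

/-- The map `R[ε] ⟶ R`, `ε ↦ 0`. -/
def dualNumberFst (R : CommRingCat.{u}) : CommRingCat.of (TrivSqZeroExt R R) ⟶ R :=
  CommRingCat.ofHom (TrivSqZeroExt.fstHom R R R).toRingHom

/-- Elements of `A` have zero differential, so no `ε`-term survives on `A`. This necessary condition
is also sufficient, by `exists_symDualNumberMap_eq`. -/
lemma comp_symDualNumberMap : φ ≫ symDualNumberMap m = (φ ≫ symIncl φ ≫ m) ≫ dualNumberInl R := by
  refine dualNumber_hom_ext (fun a ↦ ?_) fun a ↦ ?_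
  · exact fst_symDualNumberMap m (φ a)
  · refine (snd_symDualNumberMap m (φ a)).trans ?_
    rw [symD_map, map_zero]
    rfl

lemma symDualNumberMap_fst : symDualNumberMap m ≫ dualNumberFst R = symIncl φ ≫ m := by
  ext b
  exact fst_symDualNumberMap m b

/-- Ring maps `B ⟶ R[ε]` whose restriction to `A` has no `ε`-part come from `Sym_B(Ω¹_{B/A})`. -/
lemma exists_symDualNumberMap_eq (q : B ⟶ CommRingCat.of (TrivSqZeroExt R R)) (r : A ⟶ R)
    (h : φ ≫ q = r ≫ dualNumberInl R) : ∃ m : symAlg φ ⟶ R, symDualNumberMap m = q := by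
  have hmap (a : A) : (q (φ a)).snd = 0 := by
    have : q (φ a) = dualNumberInl R (r a) := ConcreteCategory.congr_hom h a
    rw [this]
    exact TrivSqZeroExt.snd_inl ..
  -- Multiplicativity of `q`, read off in the `ε`-coefficient, is the Leibniz rule along the
  -- constant coefficient.
  refine ⟨symDesc φ (q ≫ dualNumberFst R) (fun b ↦ (q b).snd) (by simp)
    (fun b b' ↦ ?_) hmap, ?_⟩
  · simp [dualNumberFst]; ring
  · refine dualNumber_hom_ext (fun b ↦ ?_) fun b ↦ ?_
    · rw [fst_symDualNumberMap, ← CommRingCat.comp_apply, symIncl_desc]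
      rfl
    · rw [snd_symDualNumberMap, symDesc_d]

end

variable {A' B' : CommRingCat.{u}} {φ' : A' ⟶ B'} {α : A ⟶ A'} {β : B ⟶ B'}

/-- Naturality of the dual number description: precomposition with `symMap` corresponds to
restriction along `β`. -/
lemma comp_symDualNumberMap_map (h : φ ≫ β = α ≫ φ') {R : CommRingCat.{u}} (m : symAlg φ' ⟶ R) :
    β ≫ symDualNumberMap m = symDualNumberMap (symMap α β h ≫ m) := by
  refine dualNumber_hom_ext (fun b ↦ ?_) fun b ↦ ?_
  · refine (fst_symDualNumberMap m (β b)).trans (.trans ?_ (fst_symDualNumberMap _ b).symm)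
    exact congr(m $(ConcreteCategory.congr_hom (symIncl_map α β h) b)).symm
  · refine (snd_symDualNumberMap m (β b)).trans (.trans ?_ (snd_symDualNumberMap _ b).symm)
    exact congr(m $(symMap_d α β h b)).symm

/-- `Sym(Ω¹)` is compatible with base change: if `B' = B ⊗_A A'`, then
`Sym_{B'}(Ω¹_{B'/A'}) = B' ⊗_B Sym_B(Ω¹_{B/A})`. -/
lemma isPushout_symMap_of_isPushout (h : IsPushout φ α β φ') :
    IsPushout β (symIncl φ) (symIncl φ') (symMap α β h.w) := by
  refine ⟨⟨by simp⟩, ⟨PushoutCocone.isColimitAux' _ fun s ↦ ?_⟩⟩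
  -- The two legs of a cocone on `B ⟵ A ⟶ A'` with vertex `R[ε]`, where `R = s.pt`. The induced map
  -- `B' ⟶ R[ε]` has no `ε`-part on `A'`, hence comes from `Sym(Ω¹_{B'/A'})`.
  have hA : φ ≫ symDualNumberMap s.inr = α ≫ (φ' ≫ s.inl) ≫ dualNumberInl s.pt := by
    have hs : symIncl φ ≫ s.inr = β ≫ s.inl := s.condition.symm
    rw [comp_symDualNumberMap, hs, reassoc_of% h.w, Category.assoc]
  have ex := exists_symDualNumberMap_eq (h.desc _ _ hA) (φ' ≫ s.inl) (h.inr_desc _ _ hA)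
  have hm := ex.choose_spec
  refine ⟨ex.choose, ?_, ?_, ?_⟩
  · change symIncl φ' ≫ _ = _
    -- Setting `ε = 0` leaves an equality of maps out of the pushout `B'`, to be tested on `B` and
    -- on `A'`.
    rw [← symDualNumberMap_fst, hm]
    refine h.hom_ext ?_ ?_
    · rw [h.inl_desc_assoc, symDualNumberMap_fst]
      exact s.condition.symm
    · rw [h.inr_desc_assoc, Category.assoc]
      rfl
  · change symMap α β h.w ≫ _ = _
    apply symDualNumberMap_injective
    rw [← comp_symDualNumberMap_map, hm, h.inl_desc]
  · suffices H : ∀ m : symAlg φ' ⟶ s.pt, symIncl φ' ≫ m = s.inl → symMap α β h.w ≫ m = s.inr →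
        m = ex.choose from fun {m} hm₁ hm₂ ↦ H m hm₁ hm₂
    intro m hm₁ hm₂
    -- For uniqueness, the map `B' ⟶ R[ε]` attached to `m` is determined on `B` by `hm₂` and on `A'`
    -- by `hm₁`.
    apply symDualNumberMap_injective
    rw [hm]
    refine h.hom_ext ?_ ?_
    · rw [h.inl_desc, comp_symDualNumberMap_map h.w, hm₂]
    · rw [h.inr_desc, comp_symDualNumberMap, hm₁]

end Algebra

/-! ### Cartesian charts and base change of tangent schemes -/

section baseChange

variable {X' S' X S : Scheme.{u}} {f' : X' ⟶ S'} {f : X ⟶ S} {g : X' ⟶ X} {s : S' ⟶ S}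

/-- For a cartesian square, charts `U ⟶ V` of `f` and affine opens `V'` of `S'` lying over `V`,
the charts `U ×_V V' ⟶ V'` of `f'`. -/
abbrev CartesianChart (f' : X' ⟶ S') (f : X ⟶ S) (g : X' ⟶ X) (s : S' ⟶ S) :=
  { c : ChartPair (f' := f') (f := f) g s // c.src.U = g ⁻¹ᵁ c.tgt.U ⊓ f' ⁻¹ᵁ c.src.V }

/-- The open in question is the fibre product `U ×_V V'` of affine schemes. -/
lemma isAffineOpen_inf_of_isPullback (h : IsPullback g f' f s) {U : X.Opens} {V : S.Opens}
    {V' : S'.Opens} (hU : IsAffineOpen U) (hV : IsAffineOpen V) (hV' : IsAffineOpen V')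
    (hUV : U ≤ f ⁻¹ᵁ V) (hVV : V' ≤ s ⁻¹ᵁ V) : IsAffineOpen (g ⁻¹ᵁ U ⊓ f' ⁻¹ᵁ V') := by
  have : IsAffine U := hU
  have : IsAffine V := hV
  have : IsAffine V' := hV'
  exact .of_isIso (Scheme.Hom.isPullback_resLE h hVV hUV rfl).isoPullback.hom

namespace CartesianChart

/-- Only a chart `U ⟶ V` around `g x` and an affine `V'` around `f' x` lying over `V` have to be
chosen; the source open is then forced. -/
lemma exists_mem (h : IsPullback g f' f s) (x : X') :
    ∃ c : CartesianChart f' f g s, x ∈ c.1.src.U := by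
  obtain ⟨c, hc, -, -⟩ := Chart.exists_mem f (g x) ⊤ trivial ⊤ trivial
  have hx : f' x ∈ s ⁻¹ᵁ c.V := by
    change s (f' x) ∈ c.V
    rw [← Scheme.Hom.comp_apply, ← h.w, Scheme.Hom.comp_apply]
    exact c.le hc
  obtain ⟨_, ⟨V', hV', rfl⟩, hxV', hV'V⟩ :=
    S'.isBasis_affineOpens.exists_subset_of_mem_open hx (s ⁻¹ᵁ c.V).2
  exact ⟨⟨⟨⟨g ⁻¹ᵁ c.U ⊓ f' ⁻¹ᵁ V', V',
    isAffineOpen_inf_of_isPullback h c.hU c.hV hV' c.le hV'V, hV', inf_le_right⟩, c,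
    inf_le_left, hV'V⟩, rfl⟩, hc, hxV'⟩

/-- The cover of `X'` by the cartesian charts. -/
abbrev cover (h : IsPullback g f' f s) : X'.OpenCover where
  I₀ := CartesianChart f' f g s
  X c := Spec Γ(X', c.1.src.U)
  f c := c.1.src.hU.fromSpec
  mem₀ := by
    rw [Scheme.presieve₀_mem_precoverage_iff]
    refine ⟨fun x ↦ ?_, fun c ↦ c.1.src.hU.isOpenImmersion_fromSpec⟩
    obtain ⟨c, hc⟩ := exists_mem h x
    refine ⟨c, ?_⟩
    rw [c.1.src.hU.range_fromSpec]
    exact hc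

/-- Since all the opens are affine, `Γ(X', U') = Γ(X, U) ⊗_{Γ(S, V)} Γ(S', V')`, and the statement
is `Spec` of the ring-level pushout. -/
lemma isPullback_map (h : IsPullback g f' f s) (c : CartesianChart f' f g s) :
    IsPullback (Chart.map g s h.w.symm c.1.src c.1.tgt c.1.hU c.1.hV) c.1.src.proj c.1.tgt.proj
      (Spec.map (g.appLE c.1.tgt.U c.1.src.U c.1.hU)) := by
  have := isIso_pushoutSection_of_isAffineOpen h c.1.hV c.1.tgt.le c.2 c.1.tgt.hV c.1.src.hV
    c.1.tgt.hU
  rw [isIso_pushoutSection_iff] at this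
  exact (isPullback_SpecMap_of_isPushout _ _ _ _ (isPushout_symMap_of_isPushout this)).flip

end CartesianChart

/-- The formation of `T_{X/S}` commutes with base change. -/
lemma isPullback_tangentMap (h : IsPullback g f' f s) :
    IsPullback (tangentMap g s h.w.symm) (tangentProj f') (tangentProj f) g := by
  refine (Scheme.isPullback_of_openCover _ _ _ _ (CartesianChart.cover h) fun c ↦ ?_).flip
  -- Paste the affine base change square with the restriction of `T_{X/S}` to `U`.
  have e : IsPullback c.1.src.proj (Chart.map g s h.w.symm c.1.src c.1.tgt c.1.hU c.1.hV ≫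
      tangentι c.1.tgt) (c.1.src.hU.fromSpec ≫ g) (tangentProj f) := by
    rw [← IsAffineOpen.SpecMap_appLE_fromSpec g c.1.tgt.hU c.1.src.hU c.1.hU]
    exact ((c.isPullback_map h).flip.paste_vert (isPullback_tangentι c.1.tgt).flip.flip)
  -- The restriction of `T_{X'/S'}` to the chart appears in the goal as a chosen pullback; `i`
  -- identifies it with the chart's own tangent scheme, so that `e` can be transported.
  have hp := IsPullback.of_hasPullback (tangentProj f') ((CartesianChart.cover h).f c)
  have hp' := (isPullback_tangentι c.1.src).flip
  let i := hp'.isoIsPullback _ _ hp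
  have hi : i.hom ≫ pullback.fst _ _ = tangentι c.1.src := hp'.isoIsPullback_hom_fst _ _ hp
  have hi' : i.hom ≫ pullback.snd _ _ = c.1.src.proj := hp'.isoIsPullback_hom_snd _ _ hp
  refine .of_iso e i (.refl _) (.refl _) (.refl _) ?_ ?_ (by simp) (by simp)
  · exact (Category.comp_id _).trans hi'.symm
  · rw [Iso.refl_hom, Category.comp_id, ← tangentι_map g s h.w.symm, ← hi, Category.assoc]
    rfl

end baseChange


/-! ### The base change isomorphism and its coherence laws -/

section baseChange

variable {X Y Z : Scheme.{u}} (f : X ⟶ Y) (g : Y ⟶ Z)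

instance isIso_baseChangeLeft {W : Scheme.{u}} (w : W ⟶ Y) : IsIso (baseChangeLeft f w) := by
  have h := IsPullback.of_hasPullback w f
  -- The pasted square exhibits `T_{W ×_Y X / X}` as the fibre product of `T_{W/Y}` and `X` over
  -- `Y`; the comparison with the chosen pullback has the same two projections as `baseChangeLeft`.
  have e : baseChangeLeft f w = ((isPullback_tangentMap h).paste_vert h).isoPullback.hom := by
    refine pullback.hom_ext ?_ ?_ <;> simp
  rw [e]
  infer_instance

instance isIso_baseChange : IsIso (baseChange f) := by
  have (W : Over Y) : IsIso ((baseChange f).app W) := by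
    have : IsIso ((Over.forget X).map ((baseChange f).app W)) :=
      isIso_baseChangeLeft f W.hom
    exact isIso_of_reflects_iso _ (Over.forget X)
  exact NatIso.isIso_of_isIso_app _

/-- The isomorphism from `f^* ∘ T_{∙/Y}` to `T_{∙/X} ∘ f^*`. -/
def baseChangeIso : tangentFunctor Y ⋙ Over.pullback f ≅ Over.pullback f ⋙ tangentFunctor X :=
  (asIso (baseChange f)).symm

/-- The compositor law on underlying schemes. The map `k` stands for `f^*` of the base change map
along `g`; describing it by its projections keeps the computation independent of how `Over.pullback`
is implemented. -/
lemma baseChangeLeft_compositor {W : Scheme.{u}} (w : W ⟶ Z)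
    (k : pullback (tangentProj (pullback.snd w g) ≫ pullback.snd w g) f ⟶
      pullback (pullback.snd (tangentProj w ≫ w) g) f)
    (hk : k ≫ pullback.fst _ _ = pullback.fst _ _ ≫ baseChangeLeft g w)
    (hk' : k ≫ pullback.snd _ _ = pullback.snd _ _) (sq) :
    baseChangeLeft f (pullback.snd w g) ≫ k ≫
        (pullbackLeftPullbackSndIso (tangentProj w ≫ w) g f).hom =
      tangentMap (f' := pullback.snd (pullback.snd w g) f) (f := pullback.snd w (f ≫ g))
        (pullbackLeftPullbackSndIso w g f).hom (𝟙 X) sq ≫ baseChangeLeft (f ≫ g) w := by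
  refine pullback.hom_ext ?_ ?_
  · simp only [Category.assoc, pullbackLeftPullbackSndIso_hom_fst, reassoc_of% hk,
      baseChangeLeft_fst]
    -- Both sides become the tangent map of the projection `(W ×_Z Y) ×_Y X ⟶ W` over `f ≫ g`.
    rw [← Category.assoc, baseChangeLeft_fst,
      tangentMap_comp (h := pullback.fst _ _ ≫ pullback.fst w g) (t := f ≫ g) _ _ _ _ _ _ rfl rfl
        (by simp [pullback.condition, pullback.condition_assoc]),
      tangentMap_comp (h := pullback.fst _ _ ≫ pullback.fst w g) (t := f ≫ g) _ _ _ _ _ _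
        (by simp) (by simp) (by simp [pullback.condition, pullback.condition_assoc])]
  · simp only [Category.assoc, pullbackLeftPullbackSndIso_hom_snd, hk', baseChangeLeft_snd,
      tangentMap_proj_assoc]

lemma baseChange_compositor :
    (Functor.associator (Over.pullback g) (Over.pullback f) (tangentFunctor X)).hom ≫
        Functor.whiskerLeft (Over.pullback g) (baseChange f) ≫
        (Functor.associator (Over.pullback g) (tangentFunctor Y) (Over.pullback f)).inv ≫
        Functor.whiskerRight (baseChange g) (Over.pullback f) ≫
        (Functor.associator (tangentFunctor Z) (Over.pullback g) (Over.pullback f)).hom ≫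
        Functor.whiskerLeft (tangentFunctor Z) (compositor f g).hom =
      Functor.whiskerRight (compositor f g).hom (tangentFunctor X) ≫ baseChange (f ≫ g) := by
  ext W : 2
  refine Over.OverMorphism.ext ?_
  simp only [NatTrans.comp_app, Functor.associator_hom_app, Functor.associator_inv_app,
    Functor.whiskerLeft_app, Functor.whiskerRight_app]
  erw [Category.id_comp, Category.id_comp, Category.id_comp]
  exact baseChangeLeft_compositor f g W.hom _ (pullback.lift_fst _ _ _) (pullback.lift_snd _ _ _) _

/-- The same law conjugated by the compositor, because `schOver` takes the inverse compositor as the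
comparison from `(f ≫ g)^*` to the composite. -/
lemma baseChange_compositor_inv :
    baseChange (f ≫ g) ≫ Functor.whiskerLeft (tangentFunctor Z) (compositor f g).inv =
      Functor.whiskerRight (compositor f g).inv (tangentFunctor X) ≫
        (Functor.associator (Over.pullback g) (Over.pullback f) (tangentFunctor X)).hom ≫
        Functor.whiskerLeft (Over.pullback g) (baseChange f) ≫
        (Functor.associator (Over.pullback g) (tangentFunctor Y) (Over.pullback f)).inv ≫
        Functor.whiskerRight (baseChange g) (Over.pullback f) ≫
        (Functor.associator (tangentFunctor Z) (Over.pullback g) (Over.pullback f)).hom := by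
  rw [← cancel_mono (Functor.isoWhiskerLeft (tangentFunctor Z) (compositor f g)).hom,
    ← cancel_epi (Functor.isoWhiskerRight (compositor f g) (tangentFunctor X)).hom]
  simp only [Category.assoc, Functor.isoWhiskerLeft_hom, Functor.isoWhiskerRight_hom,
    baseChange_compositor, ← Functor.whiskerLeft_comp, ← Functor.whiskerRight_comp_assoc,
    Iso.inv_hom_id, Functor.whiskerLeft_id', Functor.whiskerRight_id',
    Category.id_comp, Category.comp_id]

/-- The unitor is the first projection, so the law reduces to the defining first component of the
base change map along `𝟙 X`. -/
lemma baseChange_pullbackUnit (X : Scheme.{u}) :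
    baseChange (𝟙 X) ≫ Functor.whiskerLeft (tangentFunctor X) (pullbackUnit X).hom =
      Functor.whiskerRight (pullbackUnit X).hom (tangentFunctor X) ≫
        (Functor.leftUnitor _).hom ≫ (Functor.rightUnitor _).inv := by
  ext W : 2
  refine Over.OverMorphism.ext ?_
  simp only [NatTrans.comp_app, Functor.leftUnitor_hom_app, Functor.rightUnitor_inv_app,
    Functor.whiskerLeft_app, Functor.whiskerRight_app]
  erw [Category.id_comp, Category.comp_id]
  exact baseChangeLeft_fst (𝟙 X) W.hom

/-- The pseudonatural transformation with components the relative tangent functors. -/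
def tangentTrans : Pseudofunctor.StrongTrans schOver.{u} schOver.{u} where
  app X := (tangentFunctor X.as.unop).toCatHom
  naturality f := Cat.Hom.isoMk (baseChangeIso f.as.unop).symm
  naturality_naturality {a b f g} η := by
    -- The source bicategory is locally discrete, so every 2-cell is an identity.
    obtain rfl : f = g := Discrete.ext (Discrete.eq_of_hom η)
    obtain rfl : η = 𝟙 f := Subsingleton.elim _ _
    rw [PrelaxFunctor.map₂_id]
    erw [Bicategory.id_whiskerRight, Bicategory.whiskerLeft_id]
    rw [Category.id_comp, Category.comp_id]
  naturality_id X := congrArg NatTrans.toCatHom₂ (baseChange_pullbackUnit X.as.unop)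
  naturality_comp f g :=
    -- The arguments are swapped because composition takes place in the opposite category.
    congrArg NatTrans.toCatHom₂ (baseChange_compositor_inv g.as.unop f.as.unop)

end baseChange

end RelTangent

end

theorem mainTheorem8 :
    ∃ T : ∀ {X Y : Scheme.{u}} (f : X ⟶ Y),
        RelTangent.tangentFunctor Y ⋙ Over.pullback f ≅
          Over.pullback f ⋙ RelTangent.tangentFunctor X,
      (∀ {X Y : Scheme.{u}} (f : X ⟶ Y), (T f).inv = RelTangent.baseChange f) ∧
      (∀ {X Y Z : Scheme.{u}} (f : X ⟶ Y) (g : Y ⟶ Z),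
        (Functor.associator (Over.pullback g) (Over.pullback f)
              (RelTangent.tangentFunctor X)).hom ≫
            Functor.whiskerLeft (Over.pullback g) (T f).inv ≫
            (Functor.associator (Over.pullback g) (RelTangent.tangentFunctor Y)
              (Over.pullback f)).inv ≫
            Functor.whiskerRight (T g).inv (Over.pullback f) ≫
            (Functor.associator (RelTangent.tangentFunctor Z) (Over.pullback g)
              (Over.pullback f)).hom ≫
            Functor.whiskerLeft (RelTangent.tangentFunctor Z) (RelTangent.compositor f g).hom =
          Functor.whiskerRight (RelTangent.compositor f g).hom (RelTangent.tangentFunctor X) ≫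
            (T (f ≫ g)).inv) ∧
      RelTangent.IsPseudonatural (F := RelTangent.schOver.{u}) (G := RelTangent.schOver.{u})
        (fun X ↦ (RelTangent.tangentFunctor X.as.unop).toCatHom)
        (fun X Y f ↦ Cat.Hom.isoMk (T f.as.unop).symm) :=
  ⟨RelTangent.baseChangeIso, fun _ ↦ rfl, RelTangent.baseChange_compositor,
    RelTangent.tangentTrans, rfl⟩
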